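/- A partially ordered group is a group $G$ with a partial order such that $a \leq b$ implies $sat \leq sbt$ for all $a,b,s,t \in G$; write $G^+ = \{a \in G : a \geq e\}$. An $\ell$-group is a partially ordered group whose order is a lattice order, an $\ell$-subgroup is a subgroup that is also a sublattice, and a variety of $\ell$-groups is a class of $\ell$-groups defined by equations in the language $(\cdot, {}^{-1}, e, \vee, \wedge)$. A right pre-order on $G$ is identified with its positive cone, i.e. with a proper submonoid $C \subsetneq G$ such that $G = C \cup C^{-1}$ and $G^+ \subseteq C$; the corresponding right-invariant total pre-order is $a \preceq_C b \iff ba^{-1} \in C$. Let $\Omega_C$ be the chain obtained as the quotient of $G$ by the equivalence relation ($a \preceq_C b$ and $b \preceq_C a$), and let $\mathrm{Aut}(\Omega_C)$ be the $\ell$-group of order-preserving bijections of $\Omega_C$, where $f \cdot g$ is "$g$ after $f$" and the order is pointwise. Let $R_C \colon G \to \mathrm{Aut}(\Omega_C)$ be given by $R_C(a)([b]) = [ba]$, and let $H_C$ be the $\ell$-subgroup of $\mathrm{Aut}(\Omega_C)$ generated by $R_C[G]$. For a variety $\mathsf{V}$ of $\ell$-groups, a $\mathsf{V}$-right pre-order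 on $G$ is a right pre-order $C$ with $H_C \in \mathsf{V}$. The set of these carries the smallest topology containing all the sets $\mathbb{P}(a) = \{C : a \in C,\ a^{-1} \notin C\}$, $a \in G$. A topological space $X$ is generalised spectral if it is sober (every nonempty irreducible closed set is the closure of a unique point) and its compact open subsets form a base closed under binary intersections ($X$ itself need not be compact). A generalised spectral space $X$ is completely normal if for all $x, y, z \in X$ with $x, y \in \overline{\{z\}}$, either $x \in \overline{\{y\}}$ or $y \in \overline{\{x\}}$. The specialisation order of $X$ is given by: $x \preceq y$ if and only if $y \in \overline{\{x\}}$. **Corollary.** For every partially ordered group $G$ and every variety $\mathsf{V}$ of $\ell$-groups, the space of $\mathsf{V}$-right pre-orders on $G$ is a completely normal generalised spectral space, and its specialisation order is the inclusion order: for $\mathsf{V}$-right pre-orders $C, D$ on $G$, $D \in \overline{\{C\}}$ if and only if $C \subseteq D$. -/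

import Mathlib

universe u

/-! ### Lattice-ordered groups: terms, equations, varieties, `ℓ`-subgroups

An `ℓ`-group is a type `H` with `[Group H] [Lattice H] [MulLeftMono H] [MulRightMono H]`;
a partially ordered group is the same with `[PartialOrder H]` in place of `[Lattice H]`. -/

/-- Terms in the language `(·, ⁻¹, 1, ⊔, ⊓)` of `ℓ`-groups, over countably many variables. -/
inductive LTerm : Type
  | var (n : ℕ) : LTerm
  | one : LTerm
  | mul (s t : LTerm) : LTerm
  | inv (t : LTerm) : LTerm
  | sup (s t : LTerm) : LTerm
  | inf (s t : LTerm) : LTerm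

/-- The value of a term in `H` under an assignment of elements of `H` to the variables. -/
def LTerm.eval {H : Type u} [Group H] [Lattice H] (x : ℕ → H) : LTerm → H
  | .var n => x n
  | .one => 1
  | .mul s t => s.eval x * t.eval x
  | .inv t => (t.eval x)⁻¹
  | .sup s t => s.eval x ⊔ t.eval x
  | .inf s t => s.eval x ⊓ t.eval x

/-- A variety (equationally definable class) of `ℓ`-groups, given by a set of defining equations
`s ≈ t` (in addition to the axioms of `ℓ`-groups). -/
structure LGroupVariety : Type where
  equations : Set (LTerm × LTerm)

/-- The `ℓ`-group `H` belongs to the variety `V`. -/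
def LGroupVariety.Contains (V : LGroupVariety) (H : Type u) [Group H] [Lattice H]
    [MulLeftMono H] [MulRightMono H] : Prop :=
  ∀ e ∈ V.equations, ∀ x : ℕ → H, e.1.eval x = e.2.eval x

/-- An `ℓ`-subgroup: a subgroup that is also a sublattice. -/
structure LSubgroup (H : Type u) [Group H] [Lattice H] extends Subgroup H where
  sup_mem' : ∀ {a b : H}, a ∈ carrier → b ∈ carrier → a ⊔ b ∈ carrier
  inf_mem' : ∀ {a b : H}, a ∈ carrier → b ∈ carrier → a ⊓ b ∈ carrier

namespace LSubgroup

variable {H : Type u} [Group H] [Lattice H]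

instance : SetLike (LSubgroup H) H where
  coe K := K.carrier
  coe_injective K L h := by
    rcases K with ⟨K, _, _⟩
    rcases L with ⟨L, _, _⟩
    have : K = L := SetLike.coe_injective h
    subst this
    rfl

instance : SubgroupClass (LSubgroup H) H where
  mul_mem {K} _ _ ha hb := K.toSubgroup.mul_mem ha hb
  one_mem K := K.toSubgroup.one_mem
  inv_mem {K} _ ha := K.toSubgroup.inv_mem ha

instance (K : LSubgroup H) : Lattice K :=
  Subtype.lattice (fun _ _ ha hb => K.sup_mem' ha hb) (fun _ _ ha hb => K.inf_mem' ha hb)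

instance (K : LSubgroup H) [MulLeftMono H] : MulLeftMono K :=
  ⟨fun a b c h => mul_le_mul_right (α := H) (b := b.1) (c := c.1) h a.1⟩

instance (K : LSubgroup H) [MulRightMono H] : MulRightMono K :=
  ⟨fun a b c h => mul_le_mul_left (α := H) (b := b.1) (c := c.1) h a.1⟩

/-- The `ℓ`-subgroup generated by `S`: the intersection of all `ℓ`-subgroups containing `S`. -/
def closure (S : Set H) : LSubgroup H where
  carrier := {x | ∀ K : LSubgroup H, S ⊆ (K : Set H) → x ∈ K}
  mul_mem' ha hb K hK := mul_mem (ha K hK) (hb K hK)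
  one_mem' K _ := one_mem K
  inv_mem' ha K hK := inv_mem (ha K hK)
  sup_mem' ha hb K hK := K.sup_mem' (ha K hK) (hb K hK)
  inf_mem' ha hb K hK := K.inf_mem' (ha K hK) (hb K hK)

end LSubgroup

/-! ### The `ℓ`-group of automorphisms of a chain -/

/-- The order-preserving bijections of `Ω`, with `f * g` standing for "`g` after `f`" and
with the pointwise order. -/
def ChainAut (Ω : Type u) [LinearOrder Ω] : Type u := Ω ≃o Ω

namespace ChainAut

variable {Ω : Type u} [LinearOrder Ω]

instance : FunLike (ChainAut Ω) Ω Ω where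
  coe f := (show Ω ≃o Ω from f)
  coe_injective _ _ h := DFunLike.coe_injective (F := Ω ≃o Ω) h

instance : Group (ChainAut Ω) where
  mul f g := OrderIso.trans f g
  one := OrderIso.refl Ω
  inv f := OrderIso.symm f
  mul_assoc _ _ _ := rfl
  one_mul _ := rfl
  mul_one _ := rfl
  inv_mul_cancel f := OrderIso.symm_trans_self f

instance : PartialOrder (ChainAut Ω) :=
  PartialOrder.lift (fun f => (f : Ω → Ω)) DFunLike.coe_injective

theorem monotone_coe (f : ChainAut Ω) : Monotone f := OrderIso.monotone (show Ω ≃o Ω from f)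

theorem apply_inv_apply (f : ChainAut Ω) (x : Ω) : f (f⁻¹ x) = x :=
  OrderIso.apply_symm_apply (show Ω ≃o Ω from f) x

theorem inv_apply_apply (f : ChainAut Ω) (x : Ω) : f⁻¹ (f x) = x :=
  OrderIso.symm_apply_apply (show Ω ≃o Ω from f) x

/-- An automorphism from a pair of mutually inverse monotone maps. -/
def ofMonotone (f g : Ω → Ω) (hf : Monotone f) (hg : Monotone g)
    (hfg : ∀ x, f (g x) = x) (hgf : ∀ x, g (f x) = x) : ChainAut Ω :=
  { toFun := f
    invFun := g
    left_inv := hgf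
    right_inv := hfg
    map_rel_iff' := fun {a b} => ⟨fun h => by simpa [hgf] using hg h, fun h => hf h⟩ :
    Ω ≃o Ω }

instance : Lattice (ChainAut Ω) where
  sup f g := ofMonotone (fun x => f x ⊔ g x) (fun x => f⁻¹ x ⊓ g⁻¹ x)
    (fun _ _ h => sup_le_sup (f.monotone_coe h) (g.monotone_coe h))
    (fun _ _ h => inf_le_inf (f⁻¹.monotone_coe h) (g⁻¹.monotone_coe h))
    (fun x => by
      rcases le_total (f⁻¹ x) (g⁻¹ x) with h | h
      · have := g.monotone_coe h
        rw [apply_inv_apply] at this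
        simpa [inf_eq_left.2 h, apply_inv_apply] using this
      · have := f.monotone_coe h
        rw [apply_inv_apply] at this
        simpa [inf_eq_right.2 h, apply_inv_apply] using this)
    (fun x => by
      rcases le_total (f x) (g x) with h | h
      · have := f⁻¹.monotone_coe h
        rw [inv_apply_apply] at this
        simpa [sup_eq_right.2 h, inv_apply_apply] using this
      · have := g⁻¹.monotone_coe h
        rw [inv_apply_apply] at this
        simpa [sup_eq_left.2 h, inv_apply_apply] using this)
  inf f g := ofMonotone (fun x => f x ⊓ g x) (fun x => f⁻¹ x ⊔ g⁻¹ x)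
    (fun _ _ h => inf_le_inf (f.monotone_coe h) (g.monotone_coe h))
    (fun _ _ h => sup_le_sup (f⁻¹.monotone_coe h) (g⁻¹.monotone_coe h))
    (fun x => by
      rcases le_total (f⁻¹ x) (g⁻¹ x) with h | h
      · have := f.monotone_coe h
        rw [apply_inv_apply] at this
        simpa [sup_eq_right.2 h, apply_inv_apply] using this
      · have := g.monotone_coe h
        rw [apply_inv_apply] at this
        simpa [sup_eq_left.2 h, apply_inv_apply] using this)
    (fun x => by
      rcases le_total (f x) (g x) with h | h
      · have := g⁻¹.monotone_coe h
        rw [inv_apply_apply] at this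
        simpa [inf_eq_left.2 h, inv_apply_apply] using this
      · have := f⁻¹.monotone_coe h
        rw [inv_apply_apply] at this
        simpa [inf_eq_right.2 h, inv_apply_apply] using this)
  le_sup_left f g x := (le_sup_left : f x ≤ f x ⊔ g x)
  le_sup_right f g x := (le_sup_right : g x ≤ f x ⊔ g x)
  sup_le _ _ _ h₁ h₂ x := sup_le (h₁ x) (h₂ x)
  inf_le_left f g x := (inf_le_left : f x ⊓ g x ≤ f x)
  inf_le_right f g x := (inf_le_right : f x ⊓ g x ≤ g x)
  le_inf _ _ _ h₁ h₂ x := le_inf (h₁ x) (h₂ x)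

instance : MulLeftMono (ChainAut Ω) := ⟨fun f _ _ h x => h (f x)⟩

instance : MulRightMono (ChainAut Ω) := ⟨fun f _ _ h x => f.monotone_coe (h x)⟩

end ChainAut

/-! ### Right pre-orders on a partially ordered group -/

/-- A pre-cone of the partially ordered group `G`: a proper submonoid `C` with `G = C ∪ C⁻¹`
that contains the positive cone of `G`. It is identified with the right pre-order
`a ≼ b ↔ b * a⁻¹ ∈ C` on `G` (a right-invariant, total, proper pre-order extending that of `G`). -/
structure PreCone (G : Type u) [Group G] [PartialOrder G] extends Submonoid G where
  mem_of_one_le' : ∀ a : G, 1 ≤ a → a ∈ carrier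
  mem_or_inv_mem' : ∀ a : G, a ∈ carrier ∨ a⁻¹ ∈ carrier
  proper' : carrier ≠ Set.univ

namespace PreCone

variable {G : Type u} [Group G] [PartialOrder G]

instance : SetLike (PreCone G) G where
  coe C := C.carrier
  coe_injective C D h := by
    rcases C with ⟨C, _, _, _⟩
    rcases D with ⟨D, _, _, _⟩
    have : C = D := SetLike.coe_injective h
    subst this
    rfl

/-- The group `G` equipped with the right pre-order given by `C`. -/
def Carrier (_C : PreCone G) : Type u := G

instance (C : PreCone G) : Group C.Carrier := inferInstanceAs (Group G)

instance (C : PreCone G) : Preorder C.Carrier where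
  le a b := (show G from b * a⁻¹) ∈ C
  le_refl a := by
    have h : (1 : G) ∈ C := C.toSubmonoid.one_mem
    rwa [← mul_inv_cancel (show G from a)] at h
  le_trans a b c hab hbc := by
    have h : (show G from c * b⁻¹) * (show G from b * a⁻¹) ∈ C :=
      C.toSubmonoid.mul_mem hbc hab
    have e : (show G from c * b⁻¹) * (show G from b * a⁻¹) = (show G from c * a⁻¹) := by
      change (c * b⁻¹) * (b * a⁻¹) = c * a⁻¹
      group
    rwa [e] at h

theorem carrier_le_iff (C : PreCone G) (a b : C.Carrier) :
    a ≤ b ↔ (show G from b * a⁻¹) ∈ C := Iff.rfl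

theorem mul_le_mul_iff (C : PreCone G) (a b t : C.Carrier) : a * t ≤ b * t ↔ a ≤ b := by
  rw [carrier_le_iff, carrier_le_iff]
  have e : b * t * (a * t)⁻¹ = b * a⁻¹ := by group
  rw [e]

instance (C : PreCone G) : Std.Total (α := C.Carrier) (· ≤ ·) where
  total a b := by
    rcases C.mem_or_inv_mem' (show G from b * a⁻¹) with h | h
    · exact Or.inl h
    · right
      have e : (show G from b * a⁻¹)⁻¹ = (show G from a * b⁻¹) := by
        change (b * a⁻¹)⁻¹ = a * b⁻¹
        group
      rw [e] at h
      exact h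

/-- The chain `Ω_C`: the quotient of `G` by `a ≡ b ↔ a ≼ b ∧ b ≼ a`, with the induced order. -/
def Chain (C : PreCone G) : Type u := Antisymmetrization C.Carrier (· ≤ ·)

open Classical in
noncomputable instance (C : PreCone G) : LinearOrder C.Chain :=
  inferInstanceAs (LinearOrder (Antisymmetrization C.Carrier (· ≤ ·)))

/-- The class `[a]` of `a` in the chain `Ω_C`. -/
def cls (C : PreCone G) (a : G) : C.Chain := toAntisymmetrization (α := C.Carrier) (· ≤ ·) a

/-- The map `[b] ↦ [b * a]` on the chain `Ω_C`. -/
def mulRight (C : PreCone G) (a : G) : C.Chain → C.Chain :=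
  Quotient.map' (s₁ := AntisymmRel.setoid C.Carrier (· ≤ ·))
    (s₂ := AntisymmRel.setoid C.Carrier (· ≤ ·)) (fun b : C.Carrier => b * (show C.Carrier from a))
    (fun x y h => ⟨(C.mul_le_mul_iff x y a).2 h.1, (C.mul_le_mul_iff y x a).2 h.2⟩)

theorem mulRight_cls (C : PreCone G) (a b : G) : C.mulRight a (C.cls b) = C.cls (b * a) := rfl

theorem mulRight_monotone (C : PreCone G) (a : G) : Monotone (C.mulRight a) := by
  intro x y
  induction x using Quotient.inductionOn'
  induction y using Quotient.inductionOn'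
  exact (C.mul_le_mul_iff _ _ a).2

/-- The right regular representation `R_C : G → Aut Ω_C`, `R_C a [b] = [b * a]`. -/
noncomputable def regular (C : PreCone G) (a : G) : ChainAut C.Chain :=
  ChainAut.ofMonotone (C.mulRight a) (C.mulRight a⁻¹) (C.mulRight_monotone a)
    (C.mulRight_monotone a⁻¹)
    (fun x => by
      induction x using Quotient.inductionOn' with | h b => ?_
      exact congrArg C.cls (inv_mul_cancel_right (show G from b) a))
    (fun x => by
      induction x using Quotient.inductionOn' with | h b => ?_
      exact congrArg C.cls (mul_inv_cancel_right (show G from b) a))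

/-- `H_C`: the `ℓ`-subgroup of `Aut Ω_C` generated by the image of `R_C`. -/
noncomputable def lgroup (C : PreCone G) : LSubgroup (ChainAut C.Chain) :=
  LSubgroup.closure (Set.range C.regular)

end PreCone

/-- The set of `V`-right pre-orders on `G`: the right pre-orders `C` such that `H_C ∈ V`. -/
def VRightPreorder (G : Type u) [Group G] [PartialOrder G] (V : LGroupVariety) : Type u :=
  {C : PreCone G // V.Contains C.lgroup}

namespace VRightPreorder

variable {G : Type u} [Group G] [PartialOrder G] {V : LGroupVariety}

instance : SetLike (VRightPreorder G V) G where
  coe C := (C.1 : Set G)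
  coe_injective _ _ h := Subtype.ext (SetLike.coe_injective h)

/-- The set `ℙ(a)` of `V`-right pre-orders in which `a` is strictly positive. -/
def basicOpen (a : G) : Set (VRightPreorder G V) := {C | a ∈ C ∧ a⁻¹ ∉ C}

/-- The smallest topology containing all sets `ℙ(a)`. -/
instance : TopologicalSpace (VRightPreorder G V) :=
  TopologicalSpace.generateFrom (Set.range basicOpen)

end VRightPreorder

/-! ### Generalised spectral spaces -/

/-- A generalised spectral space: sober (`QuasiSober` gives existence and `T0Space` uniqueness
of generic points of irreducible closed sets), with the compact open sets forming a base
closed under binary intersections. No compactness of the whole space is required. -/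
structure IsGeneralisedSpectral (X : Type u) [TopologicalSpace X] : Prop where
  quasiSober : QuasiSober X
  t0Space : T0Space X
  isTopologicalBasis : TopologicalSpace.IsTopologicalBasis {U : Set X | IsOpen U ∧ IsCompact U}
  inter_isCompact : ∀ U W : Set X, IsOpen U → IsCompact U → IsOpen W → IsCompact W →
    IsCompact (U ∩ W)

/-- The specialisation order of a topological space. -/
def SpecialisationLE {X : Type u} [TopologicalSpace X] (x y : X) : Prop := y ∈ closure {x}

/-- A generalised spectral space is completely normal if any two points in the closure
of a point are comparable: one is in the closure of the other. -/
structure IsCompletelyNormalGeneralisedSpectral (X : Type u) [TopologicalSpace X] : Prop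
    extends IsGeneralisedSpectral X where
  completelyNormal : ∀ x y z : X, x ∈ closure {z} → y ∈ closure {z} →
    x ∈ closure {y} ∨ y ∈ closure {x}

/-! Everything rests on ultrafilter limits in the product topology on `Set G`. The limit of
pre-cones along an ultrafilter is again a pre-cone, provided some fixed element is almost always
omitted. By `contains_lgroup_of_ultralimit`, it inherits every equation valid in all the `H_{D i}`:
its `H_C` is a homomorphic image of an `ℓ`-subgroup of their product.

Since `C ∈ ℙ(a)` just means `a⁻¹ ∉ C`, such a limit is also a limit in the given topology, and the
least one under inclusion. Compactness of basic sets, stability of compact opens under intersection,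
and generic points all follow by taking this least limit. Complete normality is algebraic: the
pre-cones above a given one form a chain. -/

open Filter Topology

section LTerm

variable {H : Type u} [Group H] [Lattice H]

theorem LSubgroup.coe_eval (K : LSubgroup H) (x : ℕ → K) (t : LTerm) :
    ((t.eval x : K) : H) = t.eval (fun n => (x n : H)) := by
  induction t with
  | var n => rfl
  | one => rfl
  | mul s t hs ht => exact congrArg₂ (· * ·) hs ht
  | inv t ht => exact congrArg (·⁻¹) ht
  | sup s t hs ht => exact congrArg₂ (· ⊔ ·) hs ht
  | inf s t hs ht => exact congrArg₂ (· ⊓ ·) hs ht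

theorem LSubgroup.subset_closure (S : Set H) : S ⊆ (LSubgroup.closure S : Set H) :=
  fun _ hx _ hK => hK hx

theorem LSubgroup.closure_le {S : Set H} {K : LSubgroup H} (h : S ⊆ (K : Set H)) {x : H}
    (hx : x ∈ LSubgroup.closure S) : x ∈ K :=
  hx K h

end LTerm

namespace PreCone

variable {G : Type u} [Group G] [PartialOrder G]

theorem cls_le_cls (C : PreCone G) (a b : G) : C.cls a ≤ C.cls b ↔ b * a⁻¹ ∈ C := Iff.rfl

theorem cls_eq_cls (C : PreCone G) (a b : G) :
    C.cls a = C.cls b ↔ b * a⁻¹ ∈ C ∧ a * b⁻¹ ∈ C := by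
  rw [le_antisymm_iff, cls_le_cls, cls_le_cls]

theorem exists_cls_eq (C : PreCone G) (x : C.Chain) : ∃ a, C.cls a = x := by
  induction x using Quotient.inductionOn' with | h b => exact ⟨b, rfl⟩

theorem mem_of_inv_notMem {C : PreCone G} {a : G} (h : a⁻¹ ∉ C) : a ∈ C :=
  (C.mem_or_inv_mem' a).resolve_right h

theorem exists_notMem (C : PreCone G) : ∃ a, a ∉ C :=
  (Set.ne_univ_iff_exists_notMem _).1 C.proper'

/-- Given `d ∈ D \ E` and `e ∈ E \ D`, totality puts `d * e⁻¹` or its inverse in `C`; multiplying by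
`e` or `d` then forces `d ∈ E` or `e ∈ D`. -/
theorem subset_or_subset_of_subset {C D E : PreCone G} (hD : (C : Set G) ⊆ D)
    (hE : (C : Set G) ⊆ E) : (D : Set G) ⊆ E ∨ (E : Set G) ⊆ D := by
  by_contra! h
  obtain ⟨⟨d, hdD, hdE⟩, ⟨e, heE, heD⟩⟩ := And.imp Set.not_subset.1 Set.not_subset.1 h
  rcases C.mem_or_inv_mem' (d * e⁻¹) with hc | hc
  · have := E.mul_mem (hE hc) heE
    rw [inv_mul_cancel_right] at this
    exact hdE this
  · have := D.mul_mem (hD hc) hdD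
    rw [mul_inv_rev, inv_inv, inv_mul_cancel_right] at this
    exact heD this

/-! ### Ultrafilter limits of pre-cones -/

section Limit

variable {ι : Type*} (l : Ultrafilter ι) (D : ι → PreCone G)

/-- The limit of a family of pre-cones along an ultrafilter, provided that it is proper. -/
def ultralimit {a : G} (ha : ∀ᶠ i in l, a ∉ D i) : PreCone G where
  carrier := {b | ∀ᶠ i in l, b ∈ D i}
  mul_mem' ha hb := by
    filter_upwards [ha, hb] with i hai hbi using (D i).mul_mem hai hbi
  one_mem' := Eventually.of_forall fun i => (D i).one_mem
  mem_of_one_le' b hb := Eventually.of_forall fun i => (D i).mem_of_one_le' b hb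
  mem_or_inv_mem' b :=
    Ultrafilter.eventually_or.1 (Eventually.of_forall fun i => (D i).mem_or_inv_mem' b)
  proper' h := Ultrafilter.eventually_not.1 ha (h.ge (Set.mem_univ a))

variable {l D}

theorem mem_ultralimit {a : G} {ha : ∀ᶠ i in l, a ∉ D i} {b : G} :
    b ∈ ultralimit l D ha ↔ ∀ᶠ i in l, b ∈ D i := Iff.rfl

end Limit

/-! ### Transfer of equations to an ultrafilter limit -/

section Tracks

variable {ι : Type*} {l : Ultrafilter ι} {D : ι → PreCone G} {C : PreCone G}

/-- The point `x` of `Ω_C` and the family of points `y i` of `Ω_{D i}` have a common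
representative in `G`, for almost all `i`. -/
def PointTracks (l : Ultrafilter ι) (x : C.Chain) (y : ∀ i, (D i).Chain) : Prop :=
  ∃ c : G, x = C.cls c ∧ ∀ᶠ i in l, y i = (D i).cls c

/-- The automorphism `h` of `Ω_C` and the family of automorphisms `f i` of `Ω_{D i}`, as well as
their inverses, have common values on each element of `G`, for almost all `i`. -/
def Tracks (l : Ultrafilter ι) (h : ChainAut C.Chain) (f : ∀ i, ChainAut (D i).Chain) : Prop :=
  ∀ b : G, PointTracks l (h (C.cls b)) (fun i => f i ((D i).cls b)) ∧
    PointTracks l (h⁻¹ (C.cls b)) (fun i => (f i)⁻¹ ((D i).cls b))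

/-- Equality of two classes is a pair of membership conditions, so `hC` transfers it from almost all
`D i` back to `C`. -/
theorem PointTracks.eq (hC : ∀ b, b ∈ C ↔ ∀ᶠ i in l, b ∈ D i) {x x' : C.Chain}
    {y : ∀ i, (D i).Chain} (h : PointTracks l x y) (h' : PointTracks l x' y) : x = x' := by
  obtain ⟨c, rfl, hc⟩ := h
  obtain ⟨c', rfl, hc'⟩ := h'
  rw [cls_eq_cls, hC, hC, ← eventually_and]
  filter_upwards [hc, hc'] with i h h'
  exact ((D i).cls_eq_cls _ _).1 (h.symm.trans h')

theorem PointTracks.sup (hC : ∀ b, b ∈ C ↔ ∀ᶠ i in l, b ∈ D i) {x x' : C.Chain}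
    {y y' : ∀ i, (D i).Chain} (h : PointTracks l x y) (h' : PointTracks l x' y') :
    PointTracks l (x ⊔ x') (fun i => y i ⊔ y' i) := by
  obtain ⟨c, rfl, hc⟩ := h
  obtain ⟨c', rfl, hc'⟩ := h'
  rcases le_total (C.cls c) (C.cls c') with hle | hle
  · refine ⟨c', sup_eq_right.2 hle, ?_⟩
    filter_upwards [hc, hc', (hC _).1 hle] with i h h' hi
    rw [h, h']
    exact sup_eq_right.2 hi
  · refine ⟨c, sup_eq_left.2 hle, ?_⟩
    filter_upwards [hc, hc', (hC _).1 hle] with i h h' hi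
    rw [h, h']
    exact sup_eq_left.2 hi

theorem PointTracks.inf (hC : ∀ b, b ∈ C ↔ ∀ᶠ i in l, b ∈ D i) {x x' : C.Chain}
    {y y' : ∀ i, (D i).Chain} (h : PointTracks l x y) (h' : PointTracks l x' y') :
    PointTracks l (x ⊓ x') (fun i => y i ⊓ y' i) := by
  obtain ⟨c, rfl, hc⟩ := h
  obtain ⟨c', rfl, hc'⟩ := h'
  rcases le_total (C.cls c) (C.cls c') with hle | hle
  · refine ⟨c, inf_eq_left.2 hle, ?_⟩
    filter_upwards [hc, hc', (hC _).1 hle] with i h h' hi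
    rw [h, h']
    exact inf_eq_left.2 hi
  · refine ⟨c', inf_eq_right.2 hle, ?_⟩
    filter_upwards [hc, hc', (hC _).1 hle] with i h h' hi
    rw [h, h']
    exact inf_eq_right.2 hi

/-- The representative does not depend on `i`, so `hg` can be applied to it; this makes tracking
compatible with composition. -/
theorem PointTracks.bind {x : C.Chain} {y : ∀ i, (D i).Chain} (h : PointTracks l x y)
    {g : C.Chain → C.Chain} {k : ∀ i, (D i).Chain → (D i).Chain}
    (hg : ∀ b, PointTracks l (g (C.cls b)) (fun i => k i ((D i).cls b))) :
    PointTracks l (g x) (fun i => k i (y i)) := by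
  obtain ⟨c, rfl, hc⟩ := h
  obtain ⟨d, hd, hd'⟩ := hg c
  refine ⟨d, hd, ?_⟩
  filter_upwards [hc, hd'] with i h h'
  rw [h, h']

variable {h h' : ChainAut C.Chain} {f f' : ∀ i, ChainAut (D i).Chain}

theorem Tracks.one : Tracks l (1 : ChainAut C.Chain) (fun i => (1 : ChainAut (D i).Chain)) :=
  fun b => ⟨⟨b, rfl, Eventually.of_forall fun _ => rfl⟩,
    ⟨b, rfl, Eventually.of_forall fun _ => rfl⟩⟩

theorem Tracks.regular (a : G) : Tracks l (C.regular a) (fun i => (D i).regular a) :=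
  fun b => ⟨⟨b * a, rfl, Eventually.of_forall fun _ => rfl⟩,
    ⟨b * a⁻¹, rfl, Eventually.of_forall fun _ => rfl⟩⟩

theorem Tracks.inv (hf : Tracks l h f) : Tracks l h⁻¹ (fun i => (f i)⁻¹) :=
  fun b => ⟨(hf b).2, (hf b).1⟩

theorem Tracks.mul (hf : Tracks l h f) (hf' : Tracks l h' f') :
    Tracks l (h * h') (fun i => f i * f' i) :=
  fun b => ⟨(hf b).1.bind fun c => (hf' c).1, (hf' b).2.bind fun c => (hf c).2⟩

theorem Tracks.sup (hC : ∀ b, b ∈ C ↔ ∀ᶠ i in l, b ∈ D i) (hf : Tracks l h f)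
    (hf' : Tracks l h' f') : Tracks l (h ⊔ h') (fun i => f i ⊔ f' i) :=
  -- The inverse of a join is the meet of the inverses.
  fun b => ⟨(hf b).1.sup hC (hf' b).1, (hf b).2.inf hC (hf' b).2⟩

theorem Tracks.inf (hC : ∀ b, b ∈ C ↔ ∀ᶠ i in l, b ∈ D i) (hf : Tracks l h f)
    (hf' : Tracks l h' f') : Tracks l (h ⊓ h') (fun i => f i ⊓ f' i) :=
  fun b => ⟨(hf b).1.inf hC (hf' b).1, (hf b).2.sup hC (hf' b).2⟩

theorem Tracks.eval (hC : ∀ b, b ∈ C ↔ ∀ᶠ i in l, b ∈ D i) {x : ℕ → ChainAut C.Chain}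
    {y : ℕ → ∀ i, ChainAut (D i).Chain} (hxy : ∀ n, Tracks l (x n) (y n)) (t : LTerm) :
    Tracks l (t.eval x) (fun i => t.eval (fun n => y n i)) := by
  induction t with
  | var n => exact hxy n
  | one => exact Tracks.one
  | mul s t hs ht => exact hs.mul ht
  | inv t ht => exact ht.inv
  | sup s t hs ht => exact hs.sup hC ht
  | inf s t hs ht => exact hs.inf hC ht

theorem Tracks.eq (hC : ∀ b, b ∈ C ↔ ∀ᶠ i in l, b ∈ D i) (hf : Tracks l h f)
    (hk : Tracks l h' f) : h = h' := by
  refine DFunLike.ext _ _ fun x => ?_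
  obtain ⟨b, rfl⟩ := C.exists_cls_eq x
  exact (hf b).1.eq hC (hk b).1

/-- The automorphisms of `Ω_C` tracked by families of elements of the `H_{D i}`. -/
def tracked (hC : ∀ b, b ∈ C ↔ ∀ᶠ i in l, b ∈ D i) : LSubgroup (ChainAut C.Chain) where
  carrier := {h | ∃ f : ∀ i, (D i).lgroup, Tracks l h (fun i => (f i : ChainAut (D i).Chain))}
  mul_mem' := fun ⟨f, hf⟩ ⟨f', hf'⟩ => ⟨fun i => f i * f' i, hf.mul hf'⟩
  one_mem' := ⟨fun _ => 1, Tracks.one⟩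
  inv_mem' := fun ⟨f, hf⟩ => ⟨fun i => (f i)⁻¹, hf.inv⟩
  sup_mem' := fun ⟨f, hf⟩ ⟨f', hf'⟩ => ⟨fun i => f i ⊔ f' i, hf.sup hC hf'⟩
  inf_mem' := fun ⟨f, hf⟩ ⟨f', hf'⟩ => ⟨fun i => f i ⊓ f' i, hf.inf hC hf'⟩

theorem exists_tracks (hC : ∀ b, b ∈ C ↔ ∀ᶠ i in l, b ∈ D i) (x : C.lgroup) :
    ∃ f : ∀ i, (D i).lgroup,
      Tracks l (x : ChainAut C.Chain) (fun i => (f i : ChainAut (D i).Chain)) := by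
  refine LSubgroup.closure_le (K := tracked hC) ?_ x.2
  rintro _ ⟨a, rfl⟩
  exact ⟨fun i => ⟨(D i).regular a, LSubgroup.subset_closure _ ⟨a, rfl⟩⟩, Tracks.regular a⟩

/-- Both sides of an equation are tracked by their values on tracking families. These values agree
in each `H_{D i}`, and a family tracks at most one automorphism. -/
theorem contains_lgroup_of_ultralimit {V : LGroupVariety} (hD : ∀ i, V.Contains (D i).lgroup)
    (hC : ∀ b, b ∈ C ↔ ∀ᶠ i in l, b ∈ D i) : V.Contains C.lgroup := by
  intro e he x
  choose f hf using fun n => exists_tracks hC (x n)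
  apply Subtype.ext
  rw [LSubgroup.coe_eval, LSubgroup.coe_eval]
  refine (Tracks.eval hC hf e.1).eq hC ?_
  have key : (fun i => e.1.eval fun n => (f n i : ChainAut (D i).Chain)) =
      fun i => e.2.eval fun n => (f n i : ChainAut (D i).Chain) := by
    funext i
    rw [← LSubgroup.coe_eval _ (fun n => f n i), ← LSubgroup.coe_eval _ (fun n => f n i),
      hD i e he]
  rw [key]
  exact Tracks.eval hC hf e.2

end Tracks

end PreCone

/-! ### The topology on `V`-right pre-orders -/

namespace VRightPreorder

variable {G : Type u} [Group G] [PartialOrder G] {V : LGroupVariety}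

theorem mem_basicOpen {a : G} {C : VRightPreorder G V} : C ∈ basicOpen a ↔ a⁻¹ ∉ C :=
  ⟨fun h => h.2, fun h => ⟨PreCone.mem_of_inv_notMem (C := C.1) h, h⟩⟩

theorem isOpen_basicOpen (a : G) : IsOpen (basicOpen a : Set (VRightPreorder G V)) :=
  TopologicalSpace.isOpen_generateFrom_of_mem ⟨a, rfl⟩

theorem exists_mem_basicOpen (C : VRightPreorder G V) : ∃ a, C ∈ basicOpen a := by
  obtain ⟨a, ha⟩ := C.1.exists_notMem
  exact ⟨a⁻¹, mem_basicOpen.2 (by rwa [inv_inv])⟩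

theorem le_nhds_iff {l : Filter (VRightPreorder G V)} {C : VRightPreorder G V} :
    l ≤ 𝓝 C ↔ ∀ a ∉ C, ∀ᶠ D in l, a ∉ D := by
  rw [TopologicalSpace.nhds_generateFrom]
  simp only [le_iInf_iff, le_principal_iff]
  constructor
  · intro h a ha
    have := h (basicOpen a⁻¹) ⟨mem_basicOpen.2 (by rwa [inv_inv]), a⁻¹, rfl⟩
    filter_upwards [this] with D hD
    simpa using mem_basicOpen.1 hD
  · rintro h _ ⟨hC, a, rfl⟩
    filter_upwards [h _ (mem_basicOpen.1 hC)] with D hD using mem_basicOpen.2 hD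

theorem specializes_iff {C D : VRightPreorder G V} : C ⤳ D ↔ (C : Set G) ⊆ D := by
  rw [specializes_iff_pure, le_nhds_iff]
  simp only [eventually_pure]
  exact forall_congr' fun a => not_imp_not

theorem mem_closure_singleton_iff {C D : VRightPreorder G V} :
    D ∈ closure {C} ↔ (C : Set G) ⊆ D := by
  rw [← specializes_iff_mem_closure, specializes_iff]

/-- An ultrafilter containing some `ℙ(a)` converges in the topology induced by the product
topology on `Set G`. -/
theorem exists_patch_limit {l : Ultrafilter (VRightPreorder G V)} {a : G} (ha : basicOpen a ∈ l) :
    ∃ C : VRightPreorder G V, ∀ b, b ∈ C ↔ ∀ᶠ D : VRightPreorder G V in l, b ∈ D := by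
  have ha' : ∀ᶠ D : VRightPreorder G V in l, a⁻¹ ∉ D.1 := by
    filter_upwards [ha] with D hD using mem_basicOpen.1 hD
  exact ⟨⟨PreCone.ultralimit l (fun D => D.1) ha',
    PreCone.contains_lgroup_of_ultralimit (l := l) (fun D => D.2)
      fun _ => PreCone.mem_ultralimit⟩, fun _ => Iff.rfl⟩

theorem le_nhds_of_patch_limit {l : Ultrafilter (VRightPreorder G V)} {C : VRightPreorder G V}
    (hC : ∀ b, b ∈ C ↔ ∀ᶠ D : VRightPreorder G V in l, b ∈ D) : (l : Filter _) ≤ 𝓝 C :=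
  le_nhds_iff.2 fun a ha => Ultrafilter.eventually_not.2 fun h => ha ((hC a).2 h)

/-- With `le_nhds_of_patch_limit`, this makes `C` the least limit of `l`. -/
theorem patch_limit_subset {l : Ultrafilter (VRightPreorder G V)} {C D : VRightPreorder G V}
    (hC : ∀ b, b ∈ C ↔ ∀ᶠ D : VRightPreorder G V in l, b ∈ D) (hD : (l : Filter _) ≤ 𝓝 D) :
    (C : Set G) ⊆ D := by
  intro b hb
  by_contra hbD
  exact Ultrafilter.eventually_not.1 (le_nhds_iff.1 hD b hbD) ((hC b).1 hb)

theorem isCompact_basicOpen_inter (a : G) (s : Set G) :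
    IsCompact (basicOpen a ∩ ⋂ b ∈ s, basicOpen b : Set (VRightPreorder G V)) := by
  rw [isCompact_iff_ultrafilter_le_nhds']
  intro l hl
  obtain ⟨C, hC⟩ := exists_patch_limit (mem_of_superset hl Set.inter_subset_left)
  have mem : ∀ b, basicOpen b ∈ l → C ∈ basicOpen b := fun b hb => mem_basicOpen.2 fun h =>
    Ultrafilter.eventually_not.1 (mem_of_superset hb fun D => mem_basicOpen.1) ((hC _).1 h)
  refine ⟨C, ⟨mem a (mem_of_superset hl Set.inter_subset_left), Set.mem_iInter₂.2 fun b hb =>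
    mem b (mem_of_superset hl (Set.inter_subset_right.trans (Set.biInter_subset_of_mem hb)))⟩,
    le_nhds_of_patch_limit hC⟩

theorem isTopologicalBasis_isCompact :
    TopologicalSpace.IsTopologicalBasis
      {U : Set (VRightPreorder G V) | IsOpen U ∧ IsCompact U} := by
  refine TopologicalSpace.isTopologicalBasis_of_isOpen_of_nhds (fun U hU => hU.1) ?_
  intro C U hCU hU
  obtain ⟨W, ⟨F, ⟨hFfin, hF⟩, rfl⟩, hCW, hWU⟩ :=
    (TopologicalSpace.isTopologicalBasis_of_subbasis
      (rfl : VRightPreorder.instTopologicalSpace (G := G) (V := V) = _)).exists_subset_of_mem_open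
      hCU hU
  -- `F` may be empty, and the whole space need not be compact; the extra factor `ℙ(a)` keeps limits
  -- proper.
  obtain ⟨a, ha⟩ := exists_mem_basicOpen C
  have hW : ⋂ b ∈ basicOpen ⁻¹' F, basicOpen b = ⋂₀ F := by
    rw [← Set.sInter_image, Set.image_preimage_eq_of_subset hF]
  refine ⟨basicOpen a ∩ ⋂₀ F, ⟨(isOpen_basicOpen a).inter (hFfin.isOpen_sInter ?_), ?_⟩,
    ⟨ha, hCW⟩, Set.inter_subset_right.trans hWU⟩
  · intro W hW
    exact TopologicalSpace.isOpen_generateFrom_of_mem (hF hW)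
  · rw [← hW]
    exact isCompact_basicOpen_inter a _

/-- An ultrafilter on `U ∩ W` has limits `D ∈ U` and `E ∈ W`. Its least limit lies below both, hence
in `U` and in `W`, as open sets are closed downwards under inclusion. -/
theorem isCompact_inter {U W : Set (VRightPreorder G V)} (hU : IsOpen U) (hUc : IsCompact U)
    (hW : IsOpen W) (hWc : IsCompact W) : IsCompact (U ∩ W) := by
  rw [isCompact_iff_ultrafilter_le_nhds'] at hUc hWc ⊢
  intro l hl
  obtain ⟨D, hDU, hD⟩ := hUc l (mem_of_superset hl Set.inter_subset_left)
  obtain ⟨E, hEW, hE⟩ := hWc l (mem_of_superset hl Set.inter_subset_right)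
  obtain ⟨a, ha⟩ := exists_mem_basicOpen D
  obtain ⟨C, hC⟩ := exists_patch_limit (hD ((isOpen_basicOpen a).mem_nhds ha))
  exact ⟨C, ⟨(specializes_iff.2 (patch_limit_subset hC hD)).mem_open hU hDU,
    (specializes_iff.2 (patch_limit_subset hC hE)).mem_open hW hEW⟩, le_nhds_of_patch_limit hC⟩

theorem t0Space : T0Space (VRightPreorder G V) :=
  ⟨fun _ _ h => SetLike.coe_injective
    ((specializes_iff.1 h.specializes).antisymm (specializes_iff.1 h.specializes'))⟩

theorem quasiSober : QuasiSober (VRightPreorder G V) := by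
  refine ⟨fun {Z} hirr hZ => ?_⟩
  -- Irreducibility makes the nonempty relatively open subsets of `Z` a filter base; the least limit
  -- of an ultrafilter refining it is the generic point.
  let F : Filter (VRightPreorder G V) :=
    { sets := {S | ∃ U, IsOpen U ∧ (Z ∩ U).Nonempty ∧ Z ∩ U ⊆ S}
      univ_sets := ⟨Set.univ, isOpen_univ, by simpa using hirr.1, Set.subset_univ _⟩
      sets_of_superset := fun ⟨U, hU, hne, hs⟩ h => ⟨U, hU, hne, hs.trans h⟩
      inter_sets := fun ⟨U, hU, hne, hs⟩ ⟨W, hW, hne', hs'⟩ =>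
        ⟨U ∩ W, hU.inter hW, hirr.2 U W hU hW hne hne', fun _ h =>
          ⟨hs ⟨h.1, h.2.1⟩, hs' ⟨h.1, h.2.2⟩⟩⟩ }
  have : F.NeBot := ⟨fun h => by
    obtain ⟨U, -, hne, hs⟩ : ∅ ∈ F := h ▸ mem_bot
    exact (hne.mono hs).ne_empty rfl⟩
  have hlF : (Ultrafilter.of F : Filter _) ≤ F := Ultrafilter.of_le F
  have meets : ∀ U, IsOpen U → (Z ∩ U).Nonempty → Z ∩ U ∈ Ultrafilter.of F :=
    fun U hU hne => hlF ⟨U, hU, hne, subset_rfl⟩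
  obtain ⟨D₀, hD₀⟩ := hirr.1
  obtain ⟨a, ha⟩ := exists_mem_basicOpen D₀
  have hZa := meets _ (isOpen_basicOpen a) ⟨D₀, hD₀, ha⟩
  obtain ⟨C, hC⟩ := exists_patch_limit (mem_of_superset hZa Set.inter_subset_right)
  have hCZ : C ∈ Z := isClosed_iff_ultrafilter.1 hZ C _ (le_nhds_of_patch_limit hC)
    (mem_of_superset hZa Set.inter_subset_left)
  refine ⟨C, Set.Subset.antisymm (closure_minimal (by simpa using hCZ) hZ) fun D hD => ?_⟩
  refine mem_closure_singleton_iff.2 fun b hb => ?_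
  by_contra hbD
  -- `ℙ(b⁻¹)` meets `Z` at `D`, so it belongs to the ultrafilter, whence almost every pre-order
  -- omits `b`, contrary to `b ∈ C`.
  have hmem := meets _ (isOpen_basicOpen b⁻¹)
    ⟨D, hD, mem_basicOpen.2 (by rwa [inv_inv])⟩
  refine Ultrafilter.eventually_not.1 (mem_of_superset hmem fun E hE => ?_) ((hC b).1 hb)
  simpa using mem_basicOpen.1 hE.2

end VRightPreorder

theorem corollary2p6 (G : Type u) [Group G] [PartialOrder G] [MulLeftMono G] [MulRightMono G]
    (V : LGroupVariety) :
    IsCompletelyNormalGeneralisedSpectral (VRightPreorder G V) ∧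
      ∀ C D : VRightPreorder G V, SpecialisationLE C D ↔ (C : Set G) ⊆ (D : Set G) := by
  refine ⟨{ quasiSober := VRightPreorder.quasiSober
            t0Space := VRightPreorder.t0Space
            isTopologicalBasis := VRightPreorder.isTopologicalBasis_isCompact
            inter_isCompact := fun _ _ hU hUc hW hWc =>
              VRightPreorder.isCompact_inter hU hUc hW hWc
            completelyNormal := fun C D E hC hD => ?_ },
    fun _ _ => VRightPreorder.mem_closure_singleton_iff⟩
  rw [VRightPreorder.mem_closure_singleton_iff] at hC hD
  rw [VRightPreorder.mem_closure_singleton_iff, VRightPreorder.mem_closure_singleton_iff]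
  exact (PreCone.subset_or_subset_of_subset hC hD).symm
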